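/- Let $k$ be any field, $k_{\mathrm{sep}}$ a separable closure of $k$, and $\Gamma_k=\mathrm{Gal}(k_{\mathrm{sep}}/k)$. Let $$1\to Z\xrightarrow{\ j\ } T\xrightarrow{\ \pi\ }\overline T\to 1$$ be an exact sequence of commutative affine group schemes over $k$, where $T$ and $\overline T$ are tori (i.e. they become isomorphic to some $\mathbb{G}_m^r$ over $k_{\mathrm{sep}}$) and $Z$ is finite (not necessarily smooth). Let $T_*=\mathrm{Hom}_{k_{\mathrm{sep}}}(\mathbb{G}_m,T_{\mathrm{sep}})$ and $\overline T_*=\mathrm{Hom}_{k_{\mathrm{sep}}}(\mathbb{G}_m,\overline T_{\mathrm{sep}})$ be the groups of loops (cocharacters), and let $\varinjlim_n \mathrm{Hom}_{k_{\mathrm{sep}}}(\mu_n,Z_{\mathrm{sep}})$ be the direct limit over the positive integers ordered by divisibility, the transition map for $n\mid m$ being composition with $\mu_m\to\mu_n$, $x\mapsto x^{m/n}$. On these three groups $\Gamma_k$ acts by $f\mapsto \sigma f\sigma^{-1}$, and with this action they are $\Gamma_k$-modules, i.e. every element has an open stabilizer. Then there is a $\Gamma_k$-equivariant group homomorphism $z$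 such that $$1\to T_*\xrightarrow{\ \pi_*\ }\overline T_*\xrightarrow{\ z\ }\varinjlim_n \mathrm{Hom}_{k_{\mathrm{sep}}}(\mu_n,Z_{\mathrm{sep}})\to 1$$ is an exact sequence of $\Gamma_k$-modules. Explicitly, for every $\omega\in\overline T_*$ there is a smallest positive integer $n$ such that $n\omega=\pi_*\varphi$ for some $\varphi\in T_*$; for this $n$ and $\varphi$, the restriction of $\varphi$ to $\mu_n$ has the form $j\circ\psi$ for a homomorphism $\psi:\mu_n\to Z_{\mathrm{sep}}$, and $z(\omega)$ is the class of $\psi$ in the direct limit. -/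

import Mathlib

open scoped TensorProduct

noncomputable section

/-! An affine group scheme `G` over a field is represented by its coordinate ring, a commutative
Hopf algebra; a homomorphism `Spec D → Spec A` is a bialgebra homomorphism `A → D`; and `G` is
commutative exactly when its coordinate ring is cocommutative. -/

namespace AffGrp

section Convolution

variable {R A D : Type*} [CommRing R] [CommRing A] [HopfAlgebra R A] [Coalgebra.IsCocomm R A]
  [CommRing D] [HopfAlgebra R D]

open WithConv Bialgebra

/-- The antipode (inversion) of a commutative group scheme is compatible with comultiplication. -/
theorem antipode_comul :
    (Algebra.TensorProduct.map (HopfAlgebra.antipodeAlgHom R A)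
      (HopfAlgebra.antipodeAlgHom R A)).comp (comulAlgHom R A) =
    (comulAlgHom R A).comp (HopfAlgebra.antipodeAlgHom R A) := by
  let i₁ : A →ₐ[R] A ⊗[R] A := Algebra.TensorProduct.includeLeft
  let i₂ : A →ₐ[R] A ⊗[R] A := Algebra.TensorProduct.includeRight
  have h : (toConv (comulAlgHom R A) : WithConv (A →ₐ[R] A ⊗[R] A)) = toConv i₁ * toConv i₂ := by
    ext a
    rw [AlgHom.convMul_apply]
    change Coalgebra.comul (R := R) a = _
    generalize Coalgebra.comul (R := R) a = t
    induction t with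
    | zero => simp
    | add x y hx hy => rw [map_add, ← hx, ← hy]
    | tmul x y => simp [i₁, i₂]
  have h' : (toConv (comulAlgHom R A) : WithConv (A →ₐ[R] A ⊗[R] A))⁻¹ =
      (toConv i₁)⁻¹ * (toConv i₂)⁻¹ := by
    rw [h]
    exact mul_inv (toConv i₁) (toConv i₂)
  refine Eq.trans ?_ (congrArg ofConv h').symm
  ext a
  change _ = ((toConv i₁)⁻¹ * (toConv i₂)⁻¹ : WithConv (A →ₐ[R] A ⊗[R] A)) a
  rw [AlgHom.convMul_apply]
  change Algebra.TensorProduct.map _ _ (Coalgebra.comul (R := R) a) = _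
  generalize Coalgebra.comul (R := R) a = t
  induction t with
  | zero => simp
  | add x y hx hy => rw [map_add, map_add, hx, hy]
  | tmul x y =>
    change _ = i₁ (HopfAlgebra.antipodeAlgHom R A x) * i₂ (HopfAlgebra.antipodeAlgHom R A y)
    simp [i₁, i₂]

variable (R A) in
/-- The inversion homomorphism of a commutative affine group scheme. -/
def antipodeBialgHom : A →ₐc[R] A :=
  BialgHom.ofAlgHom (HopfAlgebra.antipodeAlgHom R A)
    AlgHom.counitAlgHom_comp_antipodeAlgHom antipode_comul

/-- Homomorphisms from a group scheme to a commutative group scheme form a commutative group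
under pointwise multiplication (convolution). -/
instance convCommGroup : CommGroup (WithConv (A →ₐc[R] D)) where
  inv f := toConv (f.ofConv.comp (antipodeBialgHom R A))
  inv_mul_cancel f := by
    have h := inv_mul_cancel (toConv f.ofConv.toAlgHom)
    ext a
    exact congrArg (fun g : WithConv (A →ₐ[R] D) => g a) h

end Convolution

section SepHom

variable (k Ks : Type*) [Field k] [Field Ks] [Algebra k Ks]

/-- `SepHom k Ks D A` is the set of homomorphisms `(Spec D)_Ks → (Spec A)_Ks` of group schemes
over `Ks`, for group schemes `Spec D`, `Spec A` over `k`. It is written additively. -/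
def SepHom (D A : Type*) [CommRing D] [HopfAlgebra k D] [CommRing A] [HopfAlgebra k A] : Type _ :=
  Additive (WithConv (Ks ⊗[k] A →ₐc[Ks] Ks ⊗[k] D))

variable {k Ks}
variable {D D' D'' A B : Type*} [CommRing D] [HopfAlgebra k D] [CommRing D'] [HopfAlgebra k D']
  [CommRing D''] [HopfAlgebra k D'']
  [CommRing A] [HopfAlgebra k A] [CommRing B] [HopfAlgebra k B]

namespace SepHom

/-- The homomorphism of group schemes given by a homomorphism of coordinate rings. -/
def mk (f : Ks ⊗[k] A →ₐc[Ks] Ks ⊗[k] D) : SepHom k Ks D A := Additive.ofMul (WithConv.toConv f)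

/-- The homomorphism of coordinate rings of a homomorphism of group schemes. -/
def hom (f : SepHom k Ks D A) : Ks ⊗[k] A →ₐc[Ks] Ks ⊗[k] D := (Additive.toMul f).ofConv

/-- Pointwise addition of homomorphisms into a commutative group scheme. -/
instance [Coalgebra.IsCocomm k A] : AddCommGroup (SepHom k Ks D A) :=
  inferInstanceAs (AddCommGroup (Additive (WithConv (Ks ⊗[k] A →ₐc[Ks] Ks ⊗[k] D))))

theorem hom_ext {f g : SepHom k Ks D A} (h : ∀ a : A, f.hom (1 ⊗ₜ a) = g.hom (1 ⊗ₜ a)) :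
    f = g := by
  have h1 : (f.hom : Ks ⊗[k] A →ₐ[Ks] Ks ⊗[k] D) = (g.hom : Ks ⊗[k] A →ₐ[Ks] Ks ⊗[k] D) := by
    ext a
    exact h a
  have h2 : f.hom = g.hom := BialgHom.coe_toAlgHom_injective h1
  exact congrArg mk h2

theorem hom_add [Coalgebra.IsCocomm k A] (f g : SepHom k Ks D A) (x : Ks ⊗[k] A) :
    (f + g).hom x = Algebra.TensorProduct.lift (f.hom : Ks ⊗[k] A →ₐ[Ks] Ks ⊗[k] D)
      (g.hom : Ks ⊗[k] A →ₐ[Ks] Ks ⊗[k] D) (fun _ _ => Commute.all _ _)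
      (Coalgebra.comul (R := Ks) x) :=
  AlgHom.convMul_apply (WithConv.toConv f.hom.toAlgHom) (WithConv.toConv g.hom.toAlgHom) x

end SepHom

/-- The action of `σ` on the coordinate ring `Ks ⊗ A` through the left factor. -/
def galRing (A : Type*) [CommRing A] [HopfAlgebra k A] (σ : Gal(Ks/k)) :
    Ks ⊗[k] A ≃ₐ[k] Ks ⊗[k] A :=
  Algebra.TensorProduct.congr σ AlgEquiv.refl

@[simp] theorem galRing_tmul (σ : Gal(Ks/k)) (c : Ks) (a : A) :
    galRing A σ (c ⊗ₜ a) = σ c ⊗ₜ a := rfl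

@[simp] theorem galRing_symm_tmul (σ : Gal(Ks/k)) (c : Ks) (a : A) :
    (galRing A σ).symm (c ⊗ₜ a) = σ.symm c ⊗ₜ a := rfl

theorem galRing_smul (σ : Gal(Ks/k)) (c : Ks) (x : Ks ⊗[k] A) :
    galRing A σ (c • x) = σ c • galRing A σ x := by
  rw [Algebra.smul_def, map_mul, Algebra.smul_def]
  simp [Algebra.TensorProduct.algebraMap_apply]

theorem galRing_one (x : Ks ⊗[k] A) : galRing A (1 : Gal(Ks/k)) x = x := by
  induction x with
  | zero => simp
  | add x y hx hy => rw [map_add, hx, hy]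
  | tmul c a => rfl

theorem galRing_mul (σ τ : Gal(Ks/k)) (x : Ks ⊗[k] A) :
    galRing A (σ * τ) x = galRing A σ (galRing A τ x) := by
  induction x with
  | zero => simp
  | add x y hx hy => simp only [map_add, hx, hy]
  | tmul c a => rfl

/-- `galRing` as a semilinear map. -/
def galLin (A : Type*) [CommRing A] [HopfAlgebra k A] (σ : Gal(Ks/k)) :
    Ks ⊗[k] A →ₛₗ[(σ : Ks →+* Ks)] Ks ⊗[k] A where
  toFun := galRing A σ
  map_add' := map_add _
  map_smul' := galRing_smul σ

@[simp] theorem galLin_apply (σ : Gal(Ks/k)) (x : Ks ⊗[k] A) :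
    galLin A σ x = galRing A σ x := rfl

theorem counit_galRing (σ : Gal(Ks/k)) (x : Ks ⊗[k] A) :
    Coalgebra.counit (R := Ks) (galRing A σ x) = σ (Coalgebra.counit (R := Ks) x) := by
  induction x with
  | zero => simp
  | add x y hx hy => simp only [map_add, hx, hy]
  | tmul c a => simp [Algebra.smul_def]

theorem comul_galRing (σ : Gal(Ks/k)) (x : Ks ⊗[k] A) :
    Coalgebra.comul (R := Ks) (galRing A σ x) =
      TensorProduct.map (galLin A σ) (galLin A σ) (Coalgebra.comul (R := Ks) x) := by
  induction x with
  | zero => simp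
  | add x y hx hy => simp only [map_add, hx, hy]
  | tmul c a =>
    simp only [galRing_tmul, TensorProduct.comul_tmul, CommSemiring.comul_apply]
    generalize Coalgebra.comul (R := k) a = t
    induction t with
    | zero => simp
    | add x y hx hy => simp only [TensorProduct.tmul_add, map_add, hx, hy]
    | tmul u v => simp

/-- The conjugate `σ ∘ f ∘ σ⁻¹` of a homomorphism of coordinate rings over `Ks`, as an algebra
homomorphism. -/
def galConjAlg (σ : Gal(Ks/k)) (f : Ks ⊗[k] A →ₐc[Ks] Ks ⊗[k] D) :
    Ks ⊗[k] A →ₐ[Ks] Ks ⊗[k] D where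
  toFun x := galRing D σ (f ((galRing A σ).symm x))
  map_one' := by simp
  map_mul' x y := by simp
  map_zero' := by simp
  map_add' x y := by simp
  commutes' c := by
    have h : (galRing A σ).symm (algebraMap Ks (Ks ⊗[k] A) c) =
        algebraMap Ks (Ks ⊗[k] A) (σ.symm c) := by
      simp [Algebra.TensorProduct.algebraMap_apply]
    have h2 : f (algebraMap Ks (Ks ⊗[k] A) (σ.symm c)) = algebraMap Ks (Ks ⊗[k] D) (σ.symm c) :=
      AlgHomClass.commutes f _
    rw [h, h2]
    simp [Algebra.TensorProduct.algebraMap_apply]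

/-- The conjugate `σ ∘ f ∘ σ⁻¹` of a homomorphism of coordinate rings over `Ks`. -/
def galConj (σ : Gal(Ks/k)) (f : Ks ⊗[k] A →ₐc[Ks] Ks ⊗[k] D) :
    Ks ⊗[k] A →ₐc[Ks] Ks ⊗[k] D :=
  BialgHom.ofAlgHom (galConjAlg σ f)
    (by
      ext a
      change Coalgebra.counit (R := Ks) (galRing D σ (f ((galRing A σ).symm (1 ⊗ₜ a)))) =
        Coalgebra.counit (R := Ks) ((1 : Ks) ⊗ₜ[k] a)
      rw [counit_galRing, CoalgHomClass.counit_comp_apply]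
      simp [Algebra.smul_def])
    (by
      ext a
      change Algebra.TensorProduct.map (galConjAlg σ f) (galConjAlg σ f)
          (Coalgebra.comul (R := Ks) ((1 : Ks) ⊗ₜ[k] a)) =
        Coalgebra.comul (R := Ks) (galRing D σ (f ((galRing A σ).symm (1 ⊗ₜ a))))
      rw [comul_galRing, ← CoalgHomClass.map_comp_comul_apply]
      simp only [galRing_symm_tmul, map_one, TensorProduct.comul_tmul, CommSemiring.comul_apply]
      generalize Coalgebra.comul (R := k) a = t
      induction t with
      | zero => simp
      | add x y hx hy => simp only [TensorProduct.tmul_add, map_add, hx, hy]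
      | tmul u v => simp [galConjAlg])

namespace SepHom

theorem hom_add_one_tmul [Coalgebra.IsCocomm k A] (f g : SepHom k Ks D A) (a : A) :
    (f + g).hom (1 ⊗ₜ a) = TensorProduct.lift ((LinearMap.mul k (Ks ⊗[k] D)).compl₁₂
      ((f.hom : Ks ⊗[k] A →ₐ[Ks] Ks ⊗[k] D).restrictScalars k |>.comp
        Algebra.TensorProduct.includeRight).toLinearMap
      ((g.hom : Ks ⊗[k] A →ₐ[Ks] Ks ⊗[k] D).restrictScalars k |>.comp
        Algebra.TensorProduct.includeRight).toLinearMap) (Coalgebra.comul (R := k) a) := by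
  rw [hom_add, TensorProduct.comul_tmul, CommSemiring.comul_apply]
  generalize Coalgebra.comul (R := k) a = t
  induction t with
  | zero => simp
  | add x y hx hy => simp only [TensorProduct.tmul_add, map_add, hx, hy]
  | tmul u v => simp

/-- The Galois action on homomorphisms over `Ks` between group schemes defined over `k`: the
element `σ` acts by conjugation, `f ↦ σ ∘ f ∘ σ⁻¹`. -/
instance : SMul Gal(Ks/k) (SepHom k Ks D A) where
  smul σ f := mk (galConj σ f.hom)

theorem smul_hom (σ : Gal(Ks/k)) (f : SepHom k Ks D A) (x : Ks ⊗[k] A) :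
    (σ • f).hom x = galRing D σ (f.hom ((galRing A σ).symm x)) := rfl

instance [Coalgebra.IsCocomm k A] : DistribMulAction Gal(Ks/k) (SepHom k Ks D A) where
  one_smul f := hom_ext fun a => by
    rw [smul_hom, galRing_one, galRing_symm_tmul, map_one]
  mul_smul σ τ f := hom_ext fun a => by
    simp only [smul_hom, galRing_mul, galRing_symm_tmul, map_one]
  smul_zero σ := hom_ext fun a => by
    change galRing D σ (algebraMap Ks (Ks ⊗[k] D) (Coalgebra.counit (R := Ks)
      ((galRing A σ).symm (1 ⊗ₜ a)))) =
        algebraMap Ks (Ks ⊗[k] D) (Coalgebra.counit (R := Ks) ((1 : Ks) ⊗ₜ[k] a))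
    simp [Algebra.TensorProduct.algebraMap_apply, Algebra.smul_def]
  smul_add σ f g := hom_ext fun a => by
    rw [smul_hom, galRing_symm_tmul, map_one, hom_add_one_tmul, hom_add_one_tmul]
    generalize Coalgebra.comul (R := k) a = t
    induction t with
    | zero => simp
    | add x y hx hy => simp only [map_add, hx, hy]
    | tmul u v => simp [smul_hom]

/-- Composition with (the base change of) a homomorphism `Spec A → Spec B` of group schemes
over `k`, as a homomorphism of Galois modules `Hom(Spec D, Spec A) → Hom(Spec D, Spec B)`. -/
def postcomp (D : Type*) [CommRing D] [HopfAlgebra k D] [Coalgebra.IsCocomm k A]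
    [Coalgebra.IsCocomm k B] (p : B →ₐc[k] A) :
    SepHom k Ks D A →+[Gal(Ks/k)] SepHom k Ks D B where
  toFun f := mk (f.hom.comp (Bialgebra.TensorProduct.map (.id Ks Ks) p))
  map_smul' σ f := hom_ext fun b => by
    change galRing D σ (f.hom ((galRing A σ).symm ((1 : Ks) ⊗ₜ[k] p b))) =
      galRing D σ (f.hom (Bialgebra.TensorProduct.map (.id Ks Ks) p
        ((galRing B σ).symm ((1 : Ks) ⊗ₜ[k] b))))
    simp
  map_zero' := hom_ext fun b => by
    change algebraMap Ks (Ks ⊗[k] D) (Coalgebra.counit (R := Ks) ((1 : Ks) ⊗ₜ[k] p b)) =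
      algebraMap Ks (Ks ⊗[k] D) (Coalgebra.counit (R := Ks) ((1 : Ks) ⊗ₜ[k] b))
    simp
  map_add' f g := hom_ext fun b => by
    rw [hom_add_one_tmul]
    change (f + g).hom ((1 : Ks) ⊗ₜ[k] p b) = _
    rw [hom_add_one_tmul, ← CoalgHomClass.map_comp_comul_apply]
    generalize Coalgebra.comul (R := k) b = t
    induction t with
    | zero => simp
    | add x y hx hy => simp only [map_add, hx, hy]
    | tmul u v =>
      change f.hom ((1 : Ks) ⊗ₜ[k] p u) * g.hom ((1 : Ks) ⊗ₜ[k] p v) =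
        f.hom ((1 : Ks) ⊗ₜ[k] p u) * g.hom ((1 : Ks) ⊗ₜ[k] p v)
      rfl

/-- Precomposition with (the base change of) a homomorphism `Spec D' → Spec D` of group schemes
over `k`, as a homomorphism of Galois modules `Hom(Spec D, Spec A) → Hom(Spec D', Spec A)`. -/
def precomp (A : Type*) [CommRing A] [HopfAlgebra k A] [Coalgebra.IsCocomm k A]
    (q : D →ₐc[k] D') : SepHom k Ks D A →+[Gal(Ks/k)] SepHom k Ks D' A where
  toFun f := mk ((Bialgebra.TensorProduct.map (.id Ks Ks) q).comp f.hom)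
  map_smul' σ f := hom_ext fun a => by
    change Bialgebra.TensorProduct.map (.id Ks Ks) q
        (galRing D σ (f.hom ((galRing A σ).symm ((1 : Ks) ⊗ₜ[k] a)))) =
      galRing D' σ (Bialgebra.TensorProduct.map (.id Ks Ks) q
        (f.hom ((galRing A σ).symm ((1 : Ks) ⊗ₜ[k] a))))
    generalize f.hom ((galRing A σ).symm ((1 : Ks) ⊗ₜ[k] a)) = t
    induction t with
    | zero => simp
    | add x y hx hy => simp only [map_add, hx, hy]
    | tmul u v => simp
  map_zero' := hom_ext fun a => by
    change Bialgebra.TensorProduct.map (.id Ks Ks) q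
        (algebraMap Ks (Ks ⊗[k] D) (Coalgebra.counit (R := Ks) ((1 : Ks) ⊗ₜ[k] a))) =
      algebraMap Ks (Ks ⊗[k] D') (Coalgebra.counit (R := Ks) ((1 : Ks) ⊗ₜ[k] a))
    simp [Algebra.TensorProduct.algebraMap_apply]
  map_add' f g := hom_ext fun a => by
    rw [hom_add_one_tmul]
    change Bialgebra.TensorProduct.map (.id Ks Ks) q ((f + g).hom ((1 : Ks) ⊗ₜ[k] a)) = _
    rw [hom_add_one_tmul]
    generalize Coalgebra.comul (R := k) a = t
    induction t with
    | zero => simp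
    | add x y hx hy => simp only [map_add, hx, hy]
    | tmul u v =>
      change Bialgebra.TensorProduct.map (.id Ks Ks) q
          (f.hom ((1 : Ks) ⊗ₜ[k] u) * g.hom ((1 : Ks) ⊗ₜ[k] v)) =
        Bialgebra.TensorProduct.map (.id Ks Ks) q (f.hom ((1 : Ks) ⊗ₜ[k] u)) *
        Bialgebra.TensorProduct.map (.id Ks Ks) q (g.hom ((1 : Ks) ⊗ₜ[k] v))
      exact map_mul (Bialgebra.TensorProduct.map (.id Ks Ks) q) _ _

theorem precomp_id [Coalgebra.IsCocomm k A] (f : SepHom k Ks D A) :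
    precomp A (.id k D) f = f := hom_ext fun a => by
  change Bialgebra.TensorProduct.map (.id Ks Ks) (.id k D) (f.hom ((1 : Ks) ⊗ₜ[k] a)) = _
  generalize f.hom ((1 : Ks) ⊗ₜ[k] a) = t
  induction t with
  | zero => simp
  | add x y hx hy => simp only [map_add, hx, hy]
  | tmul u v => simp

theorem precomp_precomp [Coalgebra.IsCocomm k A] (q : D →ₐc[k] D') (r : D' →ₐc[k] D'')
    (f : SepHom k Ks D A) : precomp A r (precomp A q f) = precomp A (r.comp q) f :=
  hom_ext fun a => by
  change Bialgebra.TensorProduct.map (.id Ks Ks) r (Bialgebra.TensorProduct.map (.id Ks Ks) q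
    (f.hom ((1 : Ks) ⊗ₜ[k] a))) =
      Bialgebra.TensorProduct.map (.id Ks Ks) (r.comp q) (f.hom ((1 : Ks) ⊗ₜ[k] a))
  generalize f.hom ((1 : Ks) ⊗ₜ[k] a) = t
  induction t with
  | zero => simp
  | add x y hx hy => simp only [map_add, hx, hy]
  | tmul u v => simp

end SepHom

end SepHom

section Tori

variable (k Ks : Type*) [Field k] [Field Ks] [Algebra k Ks]

/-- The coordinate ring `k[t, t⁻¹]` of the multiplicative group `𝔾ₘ`, as the group algebra of `ℤ`
(the elements of `ℤ` are the characters of `𝔾ₘ`). -/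
abbrev GmRing : Type _ := AddMonoidAlgebra k ℤ

/-- The coordinate ring `k[t] / (tⁿ - 1)` of the group scheme `μₙ`, as the group algebra of
`ℤ/n` (for `n > 0`). -/
abbrev MuRing (n : ℕ) : Type _ := AddMonoidAlgebra k (ZMod n)

/-- The inclusion `μₙ → 𝔾ₘ`, on coordinate rings. -/
def muToGm (n : ℕ) : GmRing k →ₐc[k] MuRing k n :=
  AddMonoidAlgebra.mapDomainBialgHom k (Int.castAddHom (ZMod n))

/-- For `n ∣ m`, the map `ℤ/n → ℤ/m` given by multiplication by `m / n`. -/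
def zmodMul {n m : ℕ} (h : n ∣ m) : ZMod n →+ ZMod m :=
  ZMod.lift n ⟨(zmultiplesHom (ZMod m)) ((m / n : ℕ) : ZMod m), by
    rw [zmultiplesHom_apply, natCast_zsmul, nsmul_eq_mul, ← Nat.cast_mul, Nat.mul_div_cancel' h,
      ZMod.natCast_self]⟩

theorem zmodMul_intCast {n m : ℕ} (h : n ∣ m) (a : ℤ) :
    zmodMul h (a : ZMod n) = a * ((m / n : ℕ) : ZMod m) := by
  simp [zmodMul]

/-- For `n ∣ m`, the homomorphism `μₘ → μₙ`, `x ↦ x ^ (m / n)`, on coordinate rings. -/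
def muPow {n m : ℕ} (h : n ∣ m) : MuRing k n →ₐc[k] MuRing k m :=
  AddMonoidAlgebra.mapDomainBialgHom k (zmodMul h)

theorem muPow_self (n : ℕ) [NeZero n] : muPow k (dvd_refl n) = .id k _ := by
  have : zmodMul (dvd_refl n) = AddMonoidHom.id _ := by
    ext a
    obtain ⟨a, rfl⟩ := ZMod.intCast_surjective a
    rw [zmodMul_intCast, Nat.div_self (NeZero.pos n)]
    simp
  rw [muPow, this, AddMonoidAlgebra.mapDomainBialgHom_id]

theorem muPow_comp {n m l : ℕ} [NeZero n] [NeZero m] (h : n ∣ m) (h' : m ∣ l) :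
    (muPow k h').comp (muPow k h) = muPow k (h.trans h') := by
  have : (zmodMul h').comp (zmodMul h) = zmodMul (h.trans h') := by
    ext a
    obtain ⟨a, rfl⟩ := ZMod.intCast_surjective a
    have e : (a : ZMod m) * ((m / n : ℕ) : ZMod m) = ((a * (m / n : ℕ) : ℤ) : ZMod m) := by
      rw [Int.cast_mul, Int.cast_natCast]
    rw [AddMonoidHom.comp_apply, zmodMul_intCast, e, zmodMul_intCast, zmodMul_intCast]
    obtain ⟨c, rfl⟩ := h
    obtain ⟨d, rfl⟩ := h'
    have hn := NeZero.pos n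
    have hc : 0 < n * c := NeZero.pos _
    rw [Nat.mul_div_cancel_left _ hc, mul_assoc n c d, Nat.mul_div_cancel_left _ hn,
      Nat.mul_div_cancel_left _ hn]
    push_cast
    ring
  rw [muPow, muPow, muPow, ← this, AddMonoidAlgebra.mapDomainBialgHom_comp]

/-- The positive natural numbers, ordered by divisibility. -/
structure PosDvd where
  val : ℕ
  pos : 0 < val

instance : Preorder PosDvd where
  le n m := n.val ∣ m.val
  le_refl n := dvd_refl n.val
  le_trans _ _ _ h h' := h.trans h'

instance : Nonempty PosDvd := ⟨⟨1, one_pos⟩⟩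

instance : IsDirectedOrder PosDvd where
  directed a b := ⟨⟨a.val * b.val, Nat.mul_pos a.pos b.pos⟩, Dvd.intro _ rfl, Dvd.intro_left _ rfl⟩

instance (n : PosDvd) : NeZero n.val := ⟨n.pos.ne'⟩

variable (C : Type*) [CommRing C] [HopfAlgebra k C] [Coalgebra.IsCocomm k C]

/-- For `n ∣ m`, the map `Hom(μₙ, Z) → Hom(μₘ, Z)`, precomposition with `x ↦ x ^ (m / n)`. -/
def muTrans (n m : PosDvd) (h : n ≤ m) :
    SepHom k Ks (MuRing k n.val) C →+[Gal(Ks/k)] SepHom k Ks (MuRing k m.val) C :=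
  SepHom.precomp C (muPow k h)

instance : DirectedSystem (fun n : PosDvd => SepHom k Ks (MuRing k n.val) C)
    (muTrans k Ks C · · ·) where
  map_self n x := by
    change SepHom.precomp C (muPow k (dvd_refl n.val)) x = x
    rw [muPow_self, SepHom.precomp_id]
  map_map l m n h h' x := by
    change SepHom.precomp C (muPow k h') (SepHom.precomp C (muPow k h) x) =
      SepHom.precomp C (muPow k (h.trans h')) x
    rw [SepHom.precomp_precomp, muPow_comp]

/-- The Galois module `lim Hom(μₙ, Z)` (homomorphisms over `Ks`, `Z = Spec C`), the direct limit
over the positive integers ordered by divisibility. -/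
abbrev MuColim : Type _ :=
  DirectLimit (fun n : PosDvd => SepHom k Ks (MuRing k n.val) C) (muTrans k Ks C)

variable {k Ks C} in
/-- The class in `lim Hom(μₙ, Z)` of a homomorphism `μₙ → Z` over `Ks`. -/
def MuColim.of (n : PosDvd) (f : SepHom k Ks (MuRing k n.val) C) : MuColim k Ks C := ⟦⟨n, f⟩⟧

/-- The group `T_* = Hom(𝔾ₘ, T)` of cocharacters (loops) over `Ks` of `T = Spec A`. -/
abbrev Cochar (A : Type*) [CommRing A] [HopfAlgebra k A] : Type _ := SepHom k Ks (GmRing k) A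

/-- `Spec A` is a torus: over `Ks` it becomes isomorphic to some `𝔾ₘʳ`, whose coordinate ring is
the group algebra of the character group `ℤʳ`. Here `Ks` is a separable closure of `k`. -/
def IsTorus (A : Type*) [CommRing A] [HopfAlgebra k A] : Prop :=
  ∃ r : ℕ, Nonempty (Ks ⊗[k] A ≃ₐc[Ks] AddMonoidAlgebra Ks (Fin r → ℤ))

/-- The sequence `1 → Z → T → T' → 1` of affine group schemes over `k` with `Z = Spec C`,
`T = Spec A`, `T' = Spec B` and maps given by `j : A → C` and `p : B → A` on coordinate rings is
exact: `Z → T` is a closed immersion with image the scheme-theoretic kernel of `T → T'` (the closed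
subscheme of `T` cut out by the augmentation ideal of `B`), and `T → T'` is surjective, which for
affine group schemes over a field means that `B → A` is injective. -/
structure IsExactSeq {k : Type*} [Field k] {A B C : Type*} [CommRing A] [HopfAlgebra k A]
    [CommRing B] [HopfAlgebra k B] [CommRing C] [HopfAlgebra k C]
    (j : A →ₐc[k] C) (p : B →ₐc[k] A) : Prop where
  closed : Function.Surjective j
  kernel : RingHom.ker j = Ideal.map p (RingHom.ker (Bialgebra.counitAlgHom k B))
  surj : Function.Injective p

/-- Every element of `M` is fixed by an open subgroup of the Galois group. -/
def IsDiscreteGaloisModule (M : Type*) [AddCommGroup M] [DistribMulAction Gal(Ks/k) M] : Prop :=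
  ∀ x : M, IsOpen (MulAction.stabilizer Gal(Ks/k) x : Set Gal(Ks/k))

end Tori

end AffGrp

end

/-!
Over the separable closure `Ks` a torus is diagonalizable: its coordinate ring is the group algebra
of its group of characters, which are the group-like elements of `Ks ⊗ A` (`CharGroup`). A quotient
Hopf algebra of a diagonalizable one is again spanned by group-like elements, so the kernel
`Z = Spec C` is diagonalizable too, and the sequence of group schemes becomes an exact sequence
`0 → X(T') → X(T) → X(Z) → 0` of character groups (`charMap_injective`, `charMap_surjective`,
`exists_charMap_eq_of_charMap_eq_zero`) with `X(T)` free and `X(Z)` finite. Homomorphisms over `Ks`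
from `Spec k[N]` to such a group scheme are the homomorphisms from its character group to `N`
(`charHom_injective`, `charHom_surjective`); for `N = ℤ` these are cocharacters, for `N = ℤ/n`
homomorphisms from `μₙ`.

The connecting homomorphism is then constructed by diagram chasing. As `X(Z)` is killed by some
`n > 0`, a multiple `n • ω` of a cocharacter `ω` of `T'` lifts to a cocharacter `φ` of `T`, and the
lift is unique because `ℤ` is torsion free. Modulo `n`, the homomorphism `φ : X(T) → ℤ` vanishes on
`X(T')`, so it factors through a homomorphism `ψ : X(Z) → ℤ/n` (`IsLift`). Passing to a common
multiple of two levels shows that the class of `ψ` in the direct limit depends only on `ω`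
(`IsLift.of_eq_of`); additivity and equivariance follow, since sums and Galois conjugates of such
triples are again of this kind. The class is zero only if `ψ = 0`, since the transition maps are
injective; then `φ` is divisible by `n`, and `ω` lifts. Every `ψ` occurs because
`X(T)` is free, so that `X(T) → X(Z) → ℤ/n` lifts to `ℤ`.

The Galois modules are discrete because coordinate rings of finite type have finitely many
generators, whose images in `Ks ⊗ D` involve finitely many algebraic elements of `Ks`.
-/

noncomputable section

namespace AffGrp

/-! ### Bialgebras spanned by group-like elements -/

section GroupLike

variable {L H H' : Type*} [Field L]

/-- A bialgebra over a field is diagonalizable if it is spanned by its group-like elements; for a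
commutative Hopf algebra this says that its spectrum is a diagonalizable group scheme. -/
def IsDiagonalizable (L H : Type*) [Field L] [CommRing H] [Bialgebra L H] : Prop :=
  Submodule.span L {x : H | IsGroupLikeElem L x} = ⊤

/-- By the linear independence of group-like elements, a set of them that spans contains all of
them. -/
theorem mem_of_isGroupLikeElem_of_span_eq_top [AddCommGroup H] [Module L H] [Coalgebra L H]
    {s : Set H} (hs : ∀ x ∈ s, IsGroupLikeElem L x) (hspan : Submodule.span L s = ⊤) {x : H}
    (hx : IsGroupLikeElem L x) : x ∈ s := by
  by_contra hxs
  have hind : LinearIndepOn L id (insert x s) :=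
    linearIndepOn_isGroupLikeElem.mono (Set.insert_subset hx hs)
  have := hind.notMem_span_of_insert hxs
  rw [Set.image_id, hspan] at this
  exact this Submodule.mem_top

variable [CommRing H] [Bialgebra L H] [CommRing H'] [Bialgebra L H']

theorem IsDiagonalizable.of_span {s : Set H} (hs : ∀ x ∈ s, IsGroupLikeElem L x)
    (hspan : Submodule.span L s = ⊤) : IsDiagonalizable L H :=
  top_unique (hspan ▸ Submodule.span_mono hs)

theorem span_image_eq_top (f : H →ₐc[L] H') (hf : Function.Surjective f) {s : Set H}
    (hspan : Submodule.span L s = ⊤) : Submodule.span L (f '' s) = ⊤ := by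
  have := Submodule.map_span ((f : H →ₐ[L] H').toLinearMap) s
  rw [hspan, Submodule.map_top] at this
  have hr : LinearMap.range (f : H →ₐ[L] H').toLinearMap = ⊤ := LinearMap.range_eq_top.2 hf
  exact this.symm.trans hr

theorem IsDiagonalizable.of_surjective (hH : IsDiagonalizable L H) (f : H →ₐc[L] H')
    (hf : Function.Surjective f) : IsDiagonalizable L H' := by
  refine .of_span (s := f '' {x | IsGroupLikeElem L x}) ?_ (span_image_eq_top f hf hH)
  rintro _ ⟨x, hx, rfl⟩
  exact hx.map f

/-- Homomorphisms out of a diagonalizable bialgebra are determined by their values on group-like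
elements. -/
theorem IsDiagonalizable.algHom_ext {R : Type*} [Ring R] [Algebra L R]
    (hH : IsDiagonalizable L H) {f g : H →ₐ[L] R} (h : ∀ x, IsGroupLikeElem L x → f x = g x) :
    f = g :=
  AlgHom.toLinearMap_injective (LinearMap.ext_on hH fun x hx => h x hx)

/-- A diagonalizable bialgebra is the monoid algebra of its group-like elements. -/
def IsDiagonalizable.equiv (hH : IsDiagonalizable L H) :
    MonoidAlgebra L (GroupLike L H) ≃ₐc[L] H :=
  .ofBijective MonoidAlgebra.liftGroupLikeBialgHom (by
    have key : ∀ x : MonoidAlgebra L (GroupLike L H), MonoidAlgebra.liftGroupLikeBialgHom x =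
        Finsupp.linearCombination L GroupLike.val x.coeff := fun x => by
      rw [MonoidAlgebra.liftGroupLikeBialgHom_apply]
      simp [MonoidAlgebra.lift_apply, Finsupp.linearCombination_apply]
    constructor
    · intro x y hxy
      rw [key, key] at hxy
      exact MonoidAlgebra.coeff_injective (linearIndep_groupLikeVal hxy)
    · intro y
      have hy : y ∈ Submodule.span L (Set.range (GroupLike.val (R := L) (A := H))) := by
        have : Set.range (GroupLike.val (R := L) (A := H)) = {x : H | IsGroupLikeElem L x} :=
          Set.ext fun x => ⟨by rintro ⟨x, rfl⟩; exact x.2, fun hx => ⟨⟨x, hx⟩, rfl⟩⟩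
        rw [this, hH]
        trivial
      rw [← Finsupp.range_linearCombination] at hy
      obtain ⟨c, rfl⟩ := hy
      exact ⟨.ofCoeff c, by rw [key]⟩)

theorem IsDiagonalizable.equiv_single (hH : IsDiagonalizable L H) (x : GroupLike L H) :
    hH.equiv (MonoidAlgebra.single x 1) = x.val := by
  change MonoidAlgebra.liftGroupLikeBialgHom (MonoidAlgebra.single x 1) = _
  simp

theorem IsDiagonalizable.equiv_symm_val (hH : IsDiagonalizable L H) (x : GroupLike L H) :
    hH.equiv.symm x.val = MonoidAlgebra.single x 1 := by
  rw [← hH.equiv_single, BialgEquiv.symm_apply_apply]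

/-- The homomorphism of group-like elements induced by a bialgebra homomorphism. -/
def groupLikeMap (f : H →ₐc[L] H') : GroupLike L H →* GroupLike L H' where
  toFun x := ⟨f x.val, x.2.map f⟩
  map_one' := by ext; simp
  map_mul' x y := by ext; simp

/-- Every monoid homomorphism between group-like elements is induced by a bialgebra homomorphism
when the source is diagonalizable. -/
theorem IsDiagonalizable.exists_bialgHom (hH : IsDiagonalizable L H)
    (g : GroupLike L H →* GroupLike L H') :
    ∃ f : H →ₐc[L] H', ∀ x, f (GroupLike.val x) = (g x).val := by
  refine ⟨(MonoidAlgebra.liftGroupLikeBialgHom.comp (MonoidAlgebra.mapDomainBialgHom L g)).comp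
    (hH.equiv.symm : H →ₐc[L] _), fun x => ?_⟩
  change MonoidAlgebra.liftGroupLikeBialgHom (MonoidAlgebra.mapDomainBialgHom L g
    (hH.equiv.symm x.val)) = _
  rw [hH.equiv_symm_val, MonoidAlgebra.mapDomainBialgHom_single]
  simp

end GroupLike

/-! ### Characters over the separable closure -/

section Characters

variable (k Ks : Type*) [Field k] [Field Ks] [Algebra k Ks]

/-- The group of characters of `Spec A` over `Ks`, written additively: a character
`(Spec A)_Ks → 𝔾ₘ` is the same thing as a group-like element of `Ks ⊗ A`. -/
abbrev CharGroup (A : Type*) [CommRing A] [HopfAlgebra k A] : Type _ :=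
  Additive (GroupLike Ks (Ks ⊗[k] A))

variable {k Ks}
variable {A B C N N' : Type*} [CommRing A] [HopfAlgebra k A] [CommRing B] [HopfAlgebra k B]
  [CommRing C] [HopfAlgebra k C] [AddCommGroup N] [AddCommGroup N']

/-- A character as an element of the coordinate ring `Ks ⊗ A`. -/
def CharGroup.val (x : CharGroup k Ks A) : Ks ⊗[k] A := x.toMul.val

theorem CharGroup.isGroupLikeElem_val (x : CharGroup k Ks A) : IsGroupLikeElem Ks x.val :=
  x.toMul.2

@[ext] theorem CharGroup.ext {x y : CharGroup k Ks A} (h : x.val = y.val) : x = y :=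
  Additive.toMul.injective (GroupLike.ext h)

variable (Ks) in
/-- The pullback of characters along the homomorphism `Spec A → Spec B` given by `p`. -/
def charMap (p : B →ₐc[k] A) : CharGroup k Ks B →+ CharGroup k Ks A :=
  MonoidHom.toAdditive (groupLikeMap (Bialgebra.TensorProduct.map (.id Ks Ks) p))

theorem charMap_injective {p : B →ₐc[k] A} (hp : Function.Injective p) :
    Function.Injective (charMap Ks p) := fun _ _ hxy => CharGroup.ext <|
  Module.Flat.lTensor_preserves_injective_linearMap (M := Ks)
    ((p : B →ₐ[k] A).toLinearMap) hp (congrArg CharGroup.val hxy)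

theorem isGroupLikeElem_one_tmul_single {M : Type*} (n : M) :
    IsGroupLikeElem Ks ((1 : Ks) ⊗ₜ[k] (AddMonoidAlgebra.single n 1 : AddMonoidAlgebra k M)) where
  counit_eq_one := by simp
  comul_eq_tmul_self := by simp

theorem span_one_tmul_single {M : Type*} : Submodule.span Ks (Set.range fun n : M =>
    (1 : Ks) ⊗ₜ[k] (AddMonoidAlgebra.single n 1 : AddMonoidAlgebra k M)) = ⊤ := by
  rw [eq_top_iff]
  intro x _
  induction x with
  | zero => exact zero_mem _
  | add x y hx hy => exact add_mem (hx trivial) (hy trivial)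
  | tmul c a =>
    induction a using AddMonoidAlgebra.induction_linear with
    | zero => simp
    | add f g hf hg => rw [TensorProduct.tmul_add]; exact add_mem (hf trivial) (hg trivial)
    | single n r =>
      have : c ⊗ₜ[k] (AddMonoidAlgebra.single n r : AddMonoidAlgebra k M) =
          (r • c) • ((1 : Ks) ⊗ₜ[k] (AddMonoidAlgebra.single n 1 : AddMonoidAlgebra k M)) := by
        rw [TensorProduct.smul_tmul', smul_eq_mul, mul_one, TensorProduct.smul_tmul,
          AddMonoidAlgebra.smul_single, smul_eq_mul, mul_one]
      rw [this]
      exact Submodule.smul_mem _ _ (Submodule.subset_span ⟨n, rfl⟩)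

theorem one_tmul_single_injective : Function.Injective fun n : N =>
    (1 : Ks) ⊗ₜ[k] (AddMonoidAlgebra.single n 1 : AddMonoidAlgebra k N) := fun _ _ h =>
  AddMonoidAlgebra.single_left_injective (R := k) one_ne_zero
    (Algebra.TensorProduct.includeRight_injective (R := k) (A := Ks) (B := AddMonoidAlgebra k N)
      (algebraMap k Ks).injective h)

variable (k Ks N) in
/-- The character group of the diagonalizable group scheme `Spec k[N]` is `N`. -/
def charGroupAddMonoidAlgebra : N ≃+ CharGroup k Ks (AddMonoidAlgebra k N) :=
  .ofBijective
    (AddMonoidHom.mk' (fun n : N => (.ofMul ⟨_, isGroupLikeElem_one_tmul_single n⟩ :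
        CharGroup k Ks (AddMonoidAlgebra k N)))
      fun m n => CharGroup.ext (by
        change (1 : Ks) ⊗ₜ[k] _ = ((1 : Ks) ⊗ₜ[k] _) * ((1 : Ks) ⊗ₜ[k] _)
        rw [Algebra.TensorProduct.tmul_mul_tmul, AddMonoidAlgebra.single_mul_single, one_mul,
          one_mul]))
    ⟨fun m n h => one_tmul_single_injective (k := k) (Ks := Ks) (congrArg CharGroup.val h),
      fun x => by
        obtain ⟨n, hn⟩ := mem_of_isGroupLikeElem_of_span_eq_top
          (by rintro _ ⟨n, rfl⟩; exact isGroupLikeElem_one_tmul_single n)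
          (span_one_tmul_single (k := k) (Ks := Ks) (M := N)) x.isGroupLikeElem_val
        exact ⟨n, CharGroup.ext hn⟩⟩

theorem baseChange_surjective {j : A →ₐc[k] C} (hj : Function.Surjective j) :
    Function.Surjective (Bialgebra.TensorProduct.map (.id Ks Ks) j) :=
  LinearMap.lTensor_surjective Ks (g := (j : A →ₐ[k] C).toLinearMap) hj

/-- If the coordinate ring of `Spec C ⊆ Spec A` is a quotient of a diagonalizable one, every
character of `Spec C` is the restriction of one of `Spec A`. -/
theorem charMap_surjective {j : A →ₐc[k] C} (hj : Function.Surjective j)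
    (hA : IsDiagonalizable Ks (Ks ⊗[k] A)) : Function.Surjective (charMap Ks j) := fun y => by
  have hspan := span_image_eq_top _ (baseChange_surjective (Ks := Ks) hj) hA
  have hgl : ∀ z ∈ Bialgebra.TensorProduct.map (.id Ks Ks) j '' {x | IsGroupLikeElem Ks x},
      IsGroupLikeElem Ks z := Set.forall_mem_image.2 fun x hx => IsGroupLikeElem.map _ hx
  obtain ⟨x, hx, hxy⟩ :=
    mem_of_isGroupLikeElem_of_span_eq_top hgl hspan y.isGroupLikeElem_val
  exact ⟨.ofMul ⟨x, hx⟩, CharGroup.ext hxy⟩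

/-- A homomorphism from the characters of `Spec A` to a group `Q` that is trivial on the characters
coming from `Spec B` is trivial on the characters that vanish on the kernel of `Spec A → Spec B`:
the induced map from `Ks ⊗ A` to the group algebra `Ks[Q]` kills the ideal of this kernel. -/
theorem map_groupLike_eq_one_of_charMap_eq_zero {j : A →ₐc[k] C} {p : B →ₐc[k] A}
    (h : IsExactSeq j p) (hA : IsDiagonalizable Ks (Ks ⊗[k] A))
    (hB : IsDiagonalizable Ks (Ks ⊗[k] B)) {Q : Type*} [Group Q]
    (q : GroupLike Ks (Ks ⊗[k] A) →* Q) (hq : ∀ y : CharGroup k Ks B, q (charMap Ks p y).toMul = 1)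
    {x : CharGroup k Ks A} (hx : charMap Ks j x = 0) : q x.toMul = 1 := by
  let θ : Ks ⊗[k] A →ₐ[Ks] MonoidAlgebra Ks Q :=
    (MonoidAlgebra.mapDomainAlgHom Ks Ks q).comp
      (hA.equiv.symm : Ks ⊗[k] A →ₐ[Ks] MonoidAlgebra Ks (GroupLike Ks (Ks ⊗[k] A)))
  have hθ : ∀ x : GroupLike Ks (Ks ⊗[k] A), θ x.val = MonoidAlgebra.single (q x) 1 := fun x => by
    change MonoidAlgebra.mapDomainBialgHom Ks q (hA.equiv.symm x.val) = _
    rw [hA.equiv_symm_val, MonoidAlgebra.mapDomainBialgHom_single]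
  have hθp : θ.comp (Bialgebra.TensorProduct.map (.id Ks Ks) p : Ks ⊗[k] B →ₐ[Ks] Ks ⊗[k] A) =
      (Algebra.ofId Ks (MonoidAlgebra Ks Q)).comp (Bialgebra.counitAlgHom Ks (Ks ⊗[k] B)) := by
    refine hB.algHom_ext fun y hy => ?_
    change θ (charMap Ks p (.ofMul ⟨y, hy⟩)).toMul.val =
      algebraMap Ks (MonoidAlgebra Ks Q) (Coalgebra.counit y)
    rw [hθ, hq, hy.counit_eq_one, map_one, MonoidAlgebra.one_def]
  have hker : RingHom.ker (Algebra.TensorProduct.map (AlgHom.id k Ks) (j : A →ₐ[k] C)) ≤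
      RingHom.ker θ := by
    rw [Algebra.TensorProduct.lTensor_ker _ h.closed, Ideal.map_le_iff_le_comap]
    change RingHom.ker j ≤ _
    rw [h.kernel, Ideal.map_le_iff_le_comap]
    intro b hb
    have hb' : Coalgebra.counit (R := k) b = 0 := hb
    have hθb : θ ((1 : Ks) ⊗ₜ p b) = algebraMap Ks (MonoidAlgebra Ks Q)
        (Coalgebra.counit (R := Ks) ((1 : Ks) ⊗ₜ[k] b)) :=
      DFunLike.congr_fun hθp ((1 : Ks) ⊗ₜ b)
    change θ ((1 : Ks) ⊗ₜ p b) = 0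
    rw [hθb, TensorProduct.counit_tmul, hb']
    simp
  have hx1 : x.val - 1 ∈ RingHom.ker θ := hker (by
    rw [RingHom.mem_ker, map_sub, map_one, sub_eq_zero]
    exact congrArg CharGroup.val hx)
  rw [RingHom.mem_ker, map_sub, map_one, sub_eq_zero] at hx1
  exact MonoidAlgebra.single_left_injective (R := Ks) one_ne_zero ((hθ x.toMul).symm.trans hx1)

/-- A character of `Spec A` that is trivial on the kernel of `Spec A → Spec B` comes from
`Spec B`. -/
theorem exists_charMap_eq_of_charMap_eq_zero {j : A →ₐc[k] C} {p : B →ₐc[k] A}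
    (h : IsExactSeq j p) (hA : IsDiagonalizable Ks (Ks ⊗[k] A))
    (hB : IsDiagonalizable Ks (Ks ⊗[k] B)) {x : CharGroup k Ks A} (hx : charMap Ks j x = 0) :
    ∃ y, charMap Ks p y = x := by
  let P := (groupLikeMap (Bialgebra.TensorProduct.map (.id Ks Ks) p)).range
  let q : GroupLike Ks (Ks ⊗[k] A) →* GroupLike Ks (Ks ⊗[k] A) ⧸ P := QuotientGroup.mk' P
  have hq : ∀ y : CharGroup k Ks B, q (charMap Ks p y).toMul = 1 := fun y =>
    (QuotientGroup.eq_one_iff (N := P) _).2 ⟨y.toMul, rfl⟩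
  have hx1 : q x.toMul = 1 := map_groupLike_eq_one_of_charMap_eq_zero h hA hB q hq hx
  obtain ⟨y, hy⟩ := (QuotientGroup.eq_one_iff (N := P) x.toMul).1 hx1
  exact ⟨.ofMul y, congrArg Additive.ofMul hy⟩

theorem charMap_charMap_eq_zero {j : A →ₐc[k] C} {p : B →ₐc[k] A} (h : IsExactSeq j p)
    (y : CharGroup k Ks B) : charMap Ks j (charMap Ks p y) = 0 := by
  have hjp : ∀ b : B, j (p b) = algebraMap k C (Coalgebra.counit b) := fun b => by
    have hb : b - algebraMap k B (Coalgebra.counit b) ∈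
        RingHom.ker (Bialgebra.counitAlgHom k B) := by simp [RingHom.mem_ker]
    have := Ideal.mem_map_of_mem p hb
    rw [← h.kernel, RingHom.mem_ker, map_sub, map_sub, sub_eq_zero] at this
    rw [this, AlgHomClass.commutes, AlgHomClass.commutes]
  have hcomp : (Bialgebra.TensorProduct.map (.id Ks Ks) j : Ks ⊗[k] A →ₐ[Ks] Ks ⊗[k] C).comp
      (Bialgebra.TensorProduct.map (.id Ks Ks) p : Ks ⊗[k] B →ₐ[Ks] Ks ⊗[k] A) =
      (Algebra.ofId Ks _).comp (Bialgebra.counitAlgHom Ks (Ks ⊗[k] B)) := by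
    ext b
    change (1 : Ks) ⊗ₜ[k] j (p b) = algebraMap Ks _ (Coalgebra.counit ((1 : Ks) ⊗ₜ[k] b))
    rw [hjp, TensorProduct.counit_tmul, Algebra.TensorProduct.algebraMap_apply,
      Algebra.algebraMap_eq_smul_one, TensorProduct.tmul_smul, TensorProduct.smul_tmul']
    rfl
  refine CharGroup.ext ((DFunLike.congr_fun hcomp y.val).trans ?_)
  change algebraMap Ks _ (Coalgebra.counit y.val) = 1
  rw [y.isGroupLikeElem_val.counit_eq_one, map_one]

theorem finite_charGroup [Module.Finite k C] : Finite (CharGroup k Ks C) :=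
  (linearIndep_groupLikeVal (R := Ks) (A := Ks ⊗[k] C)).finite

/-- The cokernel of `charMap Ks p`, the character group of the finite group scheme `Spec C`, is
annihilated by a positive integer. -/
theorem exists_pos_forall_exists_charMap_eq_nsmul [Module.Finite k C] {j : A →ₐc[k] C}
    {p : B →ₐc[k] A} (h : IsExactSeq j p)
    (hA : IsDiagonalizable Ks (Ks ⊗[k] A)) (hB : IsDiagonalizable Ks (Ks ⊗[k] B)) :
    ∃ n : ℕ, 0 < n ∧ ∀ x : CharGroup k Ks A, ∃ y, charMap Ks p y = n • x := by
  have : Finite (CharGroup k Ks C) := finite_charGroup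
  refine ⟨Nat.card (CharGroup k Ks C), Nat.card_pos, fun x => ?_⟩
  refine exists_charMap_eq_of_charMap_eq_zero h hA hB ?_
  rw [map_nsmul, card_nsmul_eq_zero']

/-- A torus is diagonalizable over `Ks`. -/
theorem IsTorus.isDiagonalizable (h : IsTorus k Ks A) : IsDiagonalizable Ks (Ks ⊗[k] A) := by
  obtain ⟨r, ⟨e⟩⟩ := h
  exact IsDiagonalizable.of_surjective (H := AddMonoidAlgebra Ks (Fin r → ℤ))
    AddMonoidAlgebra.span_isGroupLikeElem (e.symm : _ →ₐc[Ks] _) e.symm.surjective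

/-- The character group of a torus is free. -/
theorem IsTorus.free_charGroup (h : IsTorus k Ks A) : Module.Free ℤ (CharGroup k Ks A) := by
  obtain ⟨r, ⟨e⟩⟩ := h
  let f : (Fin r → ℤ) →+ CharGroup k Ks A :=
    { toFun v := .ofMul ⟨e.symm (AddMonoidAlgebra.single v 1),
        (AddMonoidAlgebra.isGroupLikeElem_single_one v).map e.symm⟩
      map_zero' := CharGroup.ext (map_one e.symm)
      map_add' v w := CharGroup.ext (by
        change e.symm _ = e.symm _ * e.symm _
        rw [← map_mul, AddMonoidAlgebra.single_mul_single, one_mul]) }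
  refine Module.Free.of_equiv
    (AddEquiv.ofBijective f ⟨fun v w hvw => ?_, fun x => ?_⟩).toIntLinearEquiv
  · exact AddMonoidAlgebra.single_left_injective one_ne_zero
      (e.symm.injective (congrArg CharGroup.val hvw))
  · obtain ⟨v, hv⟩ := AddMonoidAlgebra.isGroupLikeElem_iff_mem_range_single_one.1
      (x.isGroupLikeElem_val.map e)
    exact ⟨v, CharGroup.ext ((congrArg e.symm hv).trans (e.symm_apply_apply _))⟩

/-- The coordinate ring of a torus is of finite type, by descent along `Ks / k`. -/
theorem IsTorus.finiteType (h : IsTorus k Ks A) : Algebra.FiniteType k A := by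
  obtain ⟨r, ⟨e⟩⟩ := h
  have : Algebra.FiniteType Ks (Ks ⊗[k] A) :=
    .equiv (inferInstance : Algebra.FiniteType Ks (AddMonoidAlgebra Ks (Fin r → ℤ)))
      e.symm.toAlgEquiv
  exact .of_finiteType_tensorProduct_of_faithfullyFlat Ks

end Characters

/-! ### Homomorphisms from diagonalizable groups as homomorphisms of character groups -/

section CharHom

variable {k Ks : Type*} [Field k] [Field Ks] [Algebra k Ks]
variable {A B N N' : Type*} [CommRing A] [HopfAlgebra k A] [Coalgebra.IsCocomm k A]
  [CommRing B] [HopfAlgebra k B] [Coalgebra.IsCocomm k B] [AddCommGroup N] [AddCommGroup N']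

theorem charGroupAddMonoidAlgebra_symm_eq_iff {x : CharGroup k Ks (AddMonoidAlgebra k N)} {n : N} :
    (charGroupAddMonoidAlgebra k Ks N).symm x = n ↔ x.val = 1 ⊗ₜ AddMonoidAlgebra.single n 1 := by
  rw [AddEquiv.symm_apply_eq]
  exact ⟨fun h => congrArg CharGroup.val h, fun h => CharGroup.ext h⟩

/-- The homomorphism of character groups induced by a homomorphism over `Ks` from the
diagonalizable group scheme `Spec k[N]`, whose character group is `N`, to `Spec A`. -/
def charHom : SepHom k Ks (AddMonoidAlgebra k N) A →+ (CharGroup k Ks A →+ N) :=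
  AddMonoidHom.mk' (fun f => (charGroupAddMonoidAlgebra k Ks N).symm.toAddMonoidHom.comp
    (MonoidHom.toAdditive (groupLikeMap f.hom))) fun f g => by
      ext x
      refine charGroupAddMonoidAlgebra_symm_eq_iff.2 ?_
      change (f + g).hom x.val = (charGroupAddMonoidAlgebra k Ks N
        ((charGroupAddMonoidAlgebra k Ks N).symm (MonoidHom.toAdditive (groupLikeMap f.hom) x) +
        (charGroupAddMonoidAlgebra k Ks N).symm (MonoidHom.toAdditive (groupLikeMap g.hom) x))).val
      rw [map_add, AddEquiv.apply_symm_apply, AddEquiv.apply_symm_apply, SepHom.hom_add,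
        x.isGroupLikeElem_val.comul_eq_tmul_self, Algebra.TensorProduct.lift_tmul]
      rfl

theorem charHom_eq_iff {f : SepHom k Ks (AddMonoidAlgebra k N) A} {x : CharGroup k Ks A} {n : N} :
    charHom f x = n ↔ f.hom x.val = 1 ⊗ₜ AddMonoidAlgebra.single n 1 :=
  charGroupAddMonoidAlgebra_symm_eq_iff

theorem hom_val (f : SepHom k Ks (AddMonoidAlgebra k N) A) (x : CharGroup k Ks A) :
    f.hom x.val = 1 ⊗ₜ AddMonoidAlgebra.single (charHom f x) 1 :=
  charHom_eq_iff.1 rfl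

theorem charHom_injective (hA : IsDiagonalizable Ks (Ks ⊗[k] A)) :
    Function.Injective (charHom : SepHom k Ks (AddMonoidAlgebra k N) A →+ _) := fun f g hfg => by
  have h : (f.hom : Ks ⊗[k] A →ₐ[Ks] Ks ⊗[k] AddMonoidAlgebra k N) =
      (g.hom : Ks ⊗[k] A →ₐ[Ks] Ks ⊗[k] AddMonoidAlgebra k N) := hA.algHom_ext fun x hx => by
    let χ : CharGroup k Ks A := .ofMul ⟨x, hx⟩
    change f.hom χ.val = g.hom χ.val
    rw [hom_val, hom_val, hfg]
  exact SepHom.hom_ext fun a => DFunLike.congr_fun h (1 ⊗ₜ a)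

theorem charHom_surjective (hA : IsDiagonalizable Ks (Ks ⊗[k] A)) :
    Function.Surjective (charHom : SepHom k Ks (AddMonoidAlgebra k N) A →+ _) := fun g => by
  obtain ⟨f, hf⟩ := hA.exists_bialgHom (AddMonoidHom.toMultiplicative
    ((charGroupAddMonoidAlgebra k Ks N).toAddMonoidHom.comp g))
  exact ⟨.mk f, AddMonoidHom.ext fun x => charHom_eq_iff.2 (hf x.toMul)⟩

theorem charHom_postcomp (p : B →ₐc[k] A) (f : SepHom k Ks (AddMonoidAlgebra k N) A) :
    charHom (SepHom.postcomp _ p f) = (charHom f).comp (charMap Ks p) :=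
  AddMonoidHom.ext fun x => charHom_eq_iff.2 (hom_val f (charMap Ks p x))

theorem charHom_precomp (g : N →+ N') (f : SepHom k Ks (AddMonoidAlgebra k N) A) :
    charHom (SepHom.precomp A (AddMonoidAlgebra.mapDomainBialgHom k g) f) = g.comp (charHom f) :=
  AddMonoidHom.ext fun x => charHom_eq_iff.2 (by
    change Bialgebra.TensorProduct.map (.id Ks Ks) (AddMonoidAlgebra.mapDomainBialgHom k g)
      (f.hom x.val) = _
    rw [hom_val, Bialgebra.TensorProduct.map_tmul, AddMonoidAlgebra.mapDomainBialgHom_single]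
    rfl)

end CharHom

/-! ### Discreteness of the Galois action -/

section Discrete

variable {k Ks : Type*} [Field k] [Field Ks] [Algebra k Ks]
variable {D A : Type*} [CommRing D] [HopfAlgebra k D] [CommRing A] [HopfAlgebra k A]

/-- Every element of `Ks ⊗ D` is fixed by an open subgroup, since it involves only finitely many
elements of `Ks`, each of them algebraic over `k`. -/
theorem exists_isOpen_galRing_eq [Algebra.IsAlgebraic k Ks] (y : Ks ⊗[k] D) :
    ∃ U : Subgroup Gal(Ks/k), IsOpen (U : Set Gal(Ks/k)) ∧ ∀ σ ∈ U, galRing D σ y = y := by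
  induction y with
  | zero => exact ⟨⊤, isOpen_univ, fun σ _ => map_zero _⟩
  | tmul c d =>
    refine ⟨MulAction.stabilizer Gal(Ks/k) c, stabilizer_isOpen_of_isIntegral c, fun σ hσ => ?_⟩
    rw [galRing_tmul]
    exact congrArg (· ⊗ₜ[k] d) hσ
  | add x y hx hy =>
    obtain ⟨U, hU, hx⟩ := hx
    obtain ⟨V, hV, hy⟩ := hy
    exact ⟨U ⊓ V, hU.inter hV, fun σ hσ => by rw [map_add, hx σ hσ.1, hy σ hσ.2]⟩

/-- If the coordinate ring of `Spec A` is of finite type, a homomorphism to `Spec A` is determined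
by its values on finitely many elements of `A`, so its stabilizer is open. -/
theorem isDiscreteGaloisModule_sepHom [Algebra.IsAlgebraic k Ks] [Coalgebra.IsCocomm k A]
    [hA : Algebra.FiniteType k A] : IsDiscreteGaloisModule k Ks (SepHom k Ks D A) := fun f => by
  obtain ⟨s, hs⟩ := hA.out
  choose U hU hf using fun a : A => exists_isOpen_galRing_eq (f.hom ((1 : Ks) ⊗ₜ[k] a))
  refine Subgroup.isOpen_mono (H₁ := ⨅ a ∈ s, U a) (fun σ hσ => ?_) ?_
  · have h : ((σ • f).hom.toAlgHom.restrictScalars k).comp Algebra.TensorProduct.includeRight =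
        (f.hom.toAlgHom.restrictScalars k).comp Algebra.TensorProduct.includeRight := by
      refine AlgHom.ext_of_adjoin_eq_top hs fun a ha => ?_
      change (σ • f).hom ((1 : Ks) ⊗ₜ[k] a) = f.hom ((1 : Ks) ⊗ₜ[k] a)
      rw [SepHom.smul_hom, galRing_symm_tmul, map_one]
      exact hf a σ (by simpa using (Subgroup.mem_iInf.1 (Subgroup.mem_iInf.1 hσ a) ha))
    exact SepHom.hom_ext fun a => DFunLike.congr_fun h a
  · simp only [Subgroup.coe_iInf]
    exact s.finite_toSet.isOpen_biInter fun a _ => hU a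

theorem isDiscreteGaloisModule_muColim [Algebra.IsAlgebraic k Ks] [Coalgebra.IsCocomm k A]
    [Algebra.FiniteType k A] : IsDiscreteGaloisModule k Ks (MuColim k Ks A) := fun x => by
  induction x using DirectLimit.induction with
  | _ n f =>
    refine Subgroup.isOpen_mono (fun σ hσ => ?_) (isDiscreteGaloisModule_sepHom f)
    have hσ' : σ • f = f := hσ
    rw [MulAction.mem_stabilizer_iff, DirectLimit.smul_def, hσ']

end Discrete

/-! ### Cocharacters and their restrictions to `μₙ` -/

section Restriction

theorem zmodMul_injective {n m : ℕ} [NeZero m] (h : n ∣ m) : Function.Injective (zmodMul h) := by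
  rw [injective_iff_map_eq_zero]
  intro a ha
  obtain ⟨a, rfl⟩ := ZMod.intCast_surjective a
  obtain ⟨c, rfl⟩ := h
  have hnc : n * c ≠ 0 := NeZero.ne (n * c)
  rw [zmodMul_intCast, Nat.mul_div_cancel_left _ (Nat.pos_of_ne_zero (left_ne_zero_of_mul hnc)),
    ← Int.cast_natCast c, ← Int.cast_mul, ZMod.intCast_zmod_eq_zero_iff_dvd, Nat.cast_mul] at ha
  rw [ZMod.intCast_zmod_eq_zero_iff_dvd]
  exact Int.dvd_of_mul_dvd_mul_right (by exact_mod_cast right_ne_zero_of_mul hnc) ha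

variable {k Ks : Type*} [Field k] [Field Ks] [Algebra k Ks]
variable {A B C : Type*} [CommRing A] [HopfAlgebra k A] [Coalgebra.IsCocomm k A]
  [CommRing B] [HopfAlgebra k B] [Coalgebra.IsCocomm k B]
  [CommRing C] [HopfAlgebra k C] [Coalgebra.IsCocomm k C]

theorem charHom_muTrans {n m : PosDvd} (h : n ≤ m) (ψ : SepHom k Ks (MuRing k n.val) A) :
    charHom (muTrans k Ks A n m h ψ) = (zmodMul h).comp (charHom ψ) :=
  charHom_precomp _ _

theorem MuColim.of_muTrans {n m : PosDvd} (h : n ≤ m) (ψ : SepHom k Ks (MuRing k n.val) C) :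
    MuColim.of m (muTrans k Ks C n m h ψ) = MuColim.of n ψ :=
  (DirectLimit.eq_of_le (F := fun n : PosDvd => SepHom k Ks (MuRing k n.val) C)
    (f := muTrans k Ks C) ⟨n, ψ⟩ m h).symm

/-- The restriction of cocharacters to `μₙ`. -/
abbrev restrictMu (A : Type*) [CommRing A] [HopfAlgebra k A] [Coalgebra.IsCocomm k A] (n : ℕ) :
    Cochar k Ks A →+[Gal(Ks/k)] SepHom k Ks (MuRing k n) A :=
  SepHom.precomp A (muToGm k n)

theorem charHom_restrictMu (n : ℕ) (φ : Cochar k Ks A) :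
    charHom (restrictMu A n φ) = (Int.castAddHom (ZMod n)).comp (charHom φ) :=
  charHom_precomp _ _

theorem postcomp_restrictMu (p : B →ₐc[k] A) (n : ℕ) (φ : Cochar k Ks A) :
    restrictMu B n (SepHom.postcomp _ p φ) = SepHom.postcomp _ p (restrictMu A n φ) := rfl

theorem postcomp_muTrans (j : A →ₐc[k] C) {n m : PosDvd} (h : n ≤ m)
    (ψ : SepHom k Ks (MuRing k n.val) C) : SepHom.postcomp _ j (muTrans k Ks C n m h ψ) =
      muTrans k Ks A n m h (SepHom.postcomp _ j ψ) := rfl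

/-- On `μₘ`, the cocharacter `(m / n) • φ` is the restriction of `φ` to `μₙ` composed with
`x ↦ x ^ (m / n)`. -/
theorem restrictMu_nsmul (hA : IsDiagonalizable Ks (Ks ⊗[k] A)) {n m : PosDvd} (h : n ≤ m)
    (φ : Cochar k Ks A) : restrictMu A m.val ((m.val / n.val) • φ) =
      muTrans k Ks A n m h (restrictMu A n.val φ) := by
  refine charHom_injective hA (AddMonoidHom.ext fun x => ?_)
  rw [charHom_restrictMu, charHom_muTrans, charHom_restrictMu]
  change (((charHom ((m.val / n.val) • φ)) x : ℤ) : ZMod m.val) =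
    zmodMul h (((charHom φ x : ℤ)) : ZMod n.val)
  rw [zmodMul_intCast, map_nsmul, AddMonoidHom.nsmul_apply, nsmul_eq_mul, Int.cast_mul, mul_comm,
    Int.cast_natCast]

theorem cochar_nsmul_right_injective (hA : IsDiagonalizable Ks (Ks ⊗[k] A)) {n : ℕ} (hn : 0 < n) :
    Function.Injective fun φ : Cochar k Ks A => n • φ := fun φ φ' h =>
  charHom_injective hA (AddMonoidHom.ext fun x => by
    have hx := DFunLike.congr_fun (congrArg charHom h) x
    simp only [map_nsmul, AddMonoidHom.nsmul_apply, nsmul_eq_mul] at hx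
    exact mul_left_cancel₀ (by exact_mod_cast hn.ne') hx)

theorem restrictMu_nsmul_self (hA : IsDiagonalizable Ks (Ks ⊗[k] A)) (n : ℕ)
    (φ : Cochar k Ks A) : restrictMu A n (n • φ) = 0 :=
  charHom_injective hA (AddMonoidHom.ext fun x => by
    rw [charHom_restrictMu, map_nsmul, map_zero]
    simp)

/-- A cocharacter that is trivial on `μₙ` is divisible by `n`. -/
theorem exists_eq_nsmul_of_restrictMu_eq_zero (hA : IsDiagonalizable Ks (Ks ⊗[k] A)) {n : ℕ}
    {φ : Cochar k Ks A} (h : restrictMu A n φ = 0) : ∃ φ', φ = n • φ' := by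
  have hdvd : ∀ x, (n : ℤ) ∣ charHom φ x := fun x => by
    have hx := DFunLike.congr_fun ((charHom_restrictMu n φ).symm.trans (congrArg charHom h)) x
    rw [map_zero] at hx
    exact (ZMod.intCast_zmod_eq_zero_iff_dvd _ _).1 hx
  obtain ⟨φ', hφ'⟩ := charHom_surjective hA (AddMonoidHom.mk' (fun x => charHom φ x / n)
    fun x y => by rw [map_add, Int.add_ediv_of_dvd_left (hdvd x)])
  refine ⟨φ', charHom_injective hA (AddMonoidHom.ext fun x => ?_)⟩
  rw [map_nsmul, hφ', AddMonoidHom.nsmul_apply, nsmul_eq_mul]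
  exact (Int.mul_ediv_cancel' (hdvd x)).symm

/-- Because the character group of a torus is free, every homomorphism from `μₙ` to a torus
extends to `𝔾ₘ`. -/
theorem IsTorus.restrictMu_surjective (hT : IsTorus k Ks A) (n : ℕ) :
    Function.Surjective (restrictMu A n : Cochar k Ks A →+[Gal(Ks/k)] _) := fun ψ => by
  have := hT.free_charGroup
  obtain ⟨f, hf⟩ := Module.projective_lifting_property
    (Int.castAddHom (ZMod n)).toIntLinearMap (charHom ψ).toIntLinearMap ZMod.intCast_surjective
  obtain ⟨φ, hφ⟩ := charHom_surjective hT.isDiagonalizable f.toAddMonoidHom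
  refine ⟨φ, charHom_injective hT.isDiagonalizable (AddMonoidHom.ext fun x => ?_)⟩
  rw [charHom_restrictMu, hφ]
  exact LinearMap.congr_fun hf x

end Restriction

/-! ### The exact sequence of cocharacters -/

section ExactSequence

variable {k Ks : Type*} [Field k] [Field Ks] [Algebra k Ks]
variable {A B C : Type*} [CommRing A] [HopfAlgebra k A] [Coalgebra.IsCocomm k A]
  [CommRing B] [HopfAlgebra k B] [Coalgebra.IsCocomm k B]
  [CommRing C] [HopfAlgebra k C] {j : A →ₐc[k] C} {p : B →ₐc[k] A}

theorem postcomp_cochar_injective [Module.Finite k C] (h : IsExactSeq j p)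
    (hA : IsDiagonalizable Ks (Ks ⊗[k] A)) (hB : IsDiagonalizable Ks (Ks ⊗[k] B)) :
    Function.Injective (SepHom.postcomp (GmRing k) p : Cochar k Ks A →+[Gal(Ks/k)] _) :=
  fun φ φ' hφ => by
  obtain ⟨n, hn, hx⟩ := exists_pos_forall_exists_charMap_eq_nsmul h hA hB
  refine cochar_nsmul_right_injective hA hn (charHom_injective hA (AddMonoidHom.ext fun x => ?_))
  obtain ⟨y, hy⟩ := hx x
  have := congrArg charHom hφ
  rw [charHom_postcomp, charHom_postcomp] at this
  rw [map_nsmul, map_nsmul, AddMonoidHom.nsmul_apply, AddMonoidHom.nsmul_apply, ← map_nsmul,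
    ← map_nsmul, ← hy]
  exact DFunLike.congr_fun this y

/-- Some positive multiple of every cocharacter of `Spec B` lifts to `Spec A`. -/
theorem exists_pos_exists_postcomp_eq_nsmul [Module.Finite k C] (h : IsExactSeq j p)
    (hA : IsDiagonalizable Ks (Ks ⊗[k] A)) (hB : IsDiagonalizable Ks (Ks ⊗[k] B))
    (ω : Cochar k Ks B) :
    ∃ n : ℕ, 0 < n ∧ ∃ φ : Cochar k Ks A, SepHom.postcomp (GmRing k) p φ = n • ω := by
  obtain ⟨n, hn, hx⟩ := exists_pos_forall_exists_charMap_eq_nsmul h hA hB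
  choose y hy using hx
  have hinj := charMap_injective (Ks := Ks) h.surj
  -- On characters, the lift is `x ↦ ω(n x)`, as `n x` is a character of `Spec B`.
  obtain ⟨φ, hφ⟩ := charHom_surjective hA (AddMonoidHom.mk' (fun x => charHom ω (y x))
    fun x x' => by
      rw [← map_add]
      congr 1
      apply hinj
      rw [map_add, hy, hy, hy, nsmul_add])
  refine ⟨n, hn, φ, charHom_injective hB (AddMonoidHom.ext fun b => ?_)⟩
  have hb : y (charMap Ks p b) = n • b := hinj (by rw [hy, map_nsmul])
  rw [charHom_postcomp, hφ, map_nsmul, AddMonoidHom.nsmul_apply, ← map_nsmul, ← hb]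
  rfl

variable [Coalgebra.IsCocomm k C]

theorem postcomp_injective_of_surjective (hj : Function.Surjective j)
    (hA : IsDiagonalizable Ks (Ks ⊗[k] A)) {N : Type*} [AddCommGroup N] : Function.Injective
      (SepHom.postcomp (AddMonoidAlgebra k N) j : SepHom k Ks _ C →+[Gal(Ks/k)] _) :=
  fun ψ ψ' hψ => by
  refine charHom_injective (hA.of_surjective _ (baseChange_surjective hj))
    (AddMonoidHom.ext fun y => ?_)
  obtain ⟨x, rfl⟩ := charMap_surjective hj hA y
  have := congrArg charHom hψ
  rw [charHom_postcomp, charHom_postcomp] at this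
  exact DFunLike.congr_fun this x

/-- A homomorphism to `Spec A` whose composition with `Spec A → Spec B` is trivial factors through
the kernel `Spec C`. -/
theorem exists_postcomp_eq (h : IsExactSeq j p) (hA : IsDiagonalizable Ks (Ks ⊗[k] A))
    (hB : IsDiagonalizable Ks (Ks ⊗[k] B)) {N : Type*} [AddCommGroup N]
    {f : SepHom k Ks (AddMonoidAlgebra k N) A} (hf : SepHom.postcomp _ p f = 0) :
    ∃ ψ : SepHom k Ks (AddMonoidAlgebra k N) C, SepHom.postcomp _ j ψ = f := by
  have hker : (charMap Ks j).ker ≤ (charHom f).ker := fun x hx => by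
    obtain ⟨y, rfl⟩ := exists_charMap_eq_of_charMap_eq_zero h hA hB hx
    have := congrArg charHom hf
    rw [charHom_postcomp, map_zero] at this
    exact DFunLike.congr_fun this y
  obtain ⟨ψ, hψ⟩ := charHom_surjective (hA.of_surjective _ (baseChange_surjective h.closed))
    ((charMap Ks j).liftOfSurjective (charMap_surjective h.closed hA) ⟨charHom f, hker⟩)
  refine ⟨ψ, charHom_injective hA ?_⟩
  rw [charHom_postcomp, hψ]
  exact AddMonoidHom.liftOfRightInverse_comp _ _ _ _

theorem postcomp_postcomp_eq_zero (h : IsExactSeq j p) (hB : IsDiagonalizable Ks (Ks ⊗[k] B))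
    {N : Type*} [AddCommGroup N] (ψ : SepHom k Ks (AddMonoidAlgebra k N) C) :
    SepHom.postcomp _ p (SepHom.postcomp _ j ψ) = 0 := by
  refine charHom_injective hB (AddMonoidHom.ext fun y => ?_)
  rw [charHom_postcomp, charHom_postcomp, map_zero]
  exact (congrArg (charHom ψ) (charMap_charMap_eq_zero h y)).trans (map_zero _)

/-- The triples `(n, φ, ψ)` that define the value `[ψ]` of the connecting homomorphism at the
cocharacter `ω`: the cocharacter `φ` lifts `n • ω`, and its restriction to `μₙ` is `j ∘ ψ`. -/
structure IsLift (j : A →ₐc[k] C) (p : B →ₐc[k] A) (ω : Cochar k Ks B) (n : PosDvd)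
    (φ : Cochar k Ks A) (ψ : SepHom k Ks (MuRing k n.val) C) : Prop where
  postcomp_eq : SepHom.postcomp (GmRing k) p φ = n.val • ω
  restrictMu_eq : SepHom.postcomp (MuRing k n.val) j ψ = restrictMu A n.val φ

namespace IsLift

variable {ω ω' : Cochar k Ks B} {n m : PosDvd} {φ φ' : Cochar k Ks A}
  {ψ ψ' : SepHom k Ks (MuRing k n.val) C} {χ : SepHom k Ks (MuRing k m.val) C}

theorem add (hl : IsLift j p ω n φ ψ) (hl' : IsLift j p ω' n φ' ψ') :
    IsLift j p (ω + ω') n (φ + φ') (ψ + ψ') where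
  postcomp_eq := by rw [map_add, hl.postcomp_eq, hl'.postcomp_eq, nsmul_add]
  restrictMu_eq := by rw [map_add, map_add, hl.restrictMu_eq, hl'.restrictMu_eq]

theorem smul (hl : IsLift j p ω n φ ψ) (σ : Gal(Ks/k)) :
    IsLift j p (σ • ω) n (σ • φ) (σ • ψ) where
  postcomp_eq := by
    rw [map_smul, hl.postcomp_eq]
    exact map_nsmul (DistribSMul.toAddMonoidHom (Cochar k Ks B) σ) _ _
  restrictMu_eq := by rw [map_smul, map_smul, hl.restrictMu_eq]

/-- A lift at level `n` gives one at every multiple `m` of `n`, with the same class. -/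
theorem trans (hA : IsDiagonalizable Ks (Ks ⊗[k] A)) (hl : IsLift j p ω n φ ψ) (h : n ≤ m) :
    IsLift j p ω m ((m.val / n.val) • φ) (muTrans k Ks C n m h ψ) where
  postcomp_eq := by
    rw [map_nsmul, hl.postcomp_eq, ← mul_nsmul, Nat.mul_div_cancel' h]
  restrictMu_eq := by
    rw [postcomp_muTrans, hl.restrictMu_eq, restrictMu_nsmul hA h]

/-- The class of `ψ` depends only on `ω`. -/
theorem of_eq_of [Module.Finite k C] (h : IsExactSeq j p)
    (hA : IsDiagonalizable Ks (Ks ⊗[k] A)) (hB : IsDiagonalizable Ks (Ks ⊗[k] B))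
    (hl : IsLift j p ω n φ ψ) (hl' : IsLift j p ω m φ' χ) :
    MuColim.of n ψ = MuColim.of m χ := by
  obtain ⟨l, hnl, hml⟩ := exists_ge_ge n m
  have h1 := hl.trans hA hnl
  have h2 := hl'.trans hA hml
  have hφ := postcomp_cochar_injective h hA hB (h1.postcomp_eq.trans h2.postcomp_eq.symm)
  rw [← MuColim.of_muTrans hnl, ← MuColim.of_muTrans hml]
  congr 1
  exact postcomp_injective_of_surjective h.closed hA
    (h1.restrictMu_eq.trans ((congrArg _ hφ).trans h2.restrictMu_eq.symm))

end IsLift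

/-- Every lift `φ` of `n • ω` restricts to a homomorphism from `μₙ` to the kernel `Spec C`. -/
theorem exists_isLift_of_postcomp_eq (h : IsExactSeq j p) (hA : IsDiagonalizable Ks (Ks ⊗[k] A))
    (hB : IsDiagonalizable Ks (Ks ⊗[k] B)) {ω : Cochar k Ks B} {n : PosDvd} {φ : Cochar k Ks A}
    (hφ : SepHom.postcomp (GmRing k) p φ = n.val • ω) : ∃ ψ, IsLift j p ω n φ ψ := by
  obtain ⟨ψ, hψ⟩ := exists_postcomp_eq (f := restrictMu A n.val φ) h hA hB (by
    rw [← postcomp_restrictMu, hφ, restrictMu_nsmul_self hB])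
  exact ⟨ψ, hφ, hψ⟩

theorem exists_isLift [Module.Finite k C] (h : IsExactSeq j p)
    (hA : IsDiagonalizable Ks (Ks ⊗[k] A)) (hB : IsDiagonalizable Ks (Ks ⊗[k] B))
    (ω : Cochar k Ks B) : ∃ x : Σ n : PosDvd, SepHom k Ks (MuRing k n.val) C,
      ∃ φ, IsLift j p ω x.1 φ x.2 := by
  obtain ⟨n, hn, φ, hφ⟩ := exists_pos_exists_postcomp_eq_nsmul h hA hB ω
  obtain ⟨ψ, hψ⟩ := exists_isLift_of_postcomp_eq (n := ⟨n, hn⟩) h hA hB hφ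
  exact ⟨⟨_, ψ⟩, φ, hψ⟩

/-- The connecting homomorphism on cocharacters exists: it sends `ω` to the class of `ψ` for any
triple `(n, φ, ψ)` as in `IsLift`. -/
theorem exists_connectingHom [Module.Finite k C] (h : IsExactSeq j p)
    (hA : IsDiagonalizable Ks (Ks ⊗[k] A)) (hB : IsDiagonalizable Ks (Ks ⊗[k] B)) :
    ∃ z : Cochar k Ks B →+[Gal(Ks/k)] MuColim k Ks C,
      ∀ ω n φ ψ, IsLift j p ω n φ ψ → z ω = MuColim.of n ψ := by
  choose x φ hx using exists_isLift (Ks := Ks) h hA hB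
  have key : ∀ {ω n φ' ψ}, IsLift j p ω n φ' ψ → MuColim.of (x ω).1 (x ω).2 = MuColim.of n ψ :=
    fun hl => (hx _).of_eq_of h hA hB hl
  refine ⟨{
    toFun := fun ω => MuColim.of (x ω).1 (x ω).2
    map_smul' := fun σ ω => ?_
    map_zero' := ?_
    map_add' := fun ω ω' => ?_ }, fun ω n φ' ψ hl => key hl⟩
  · exact (key ((hx ω).smul σ)).trans (DirectLimit.smul_def _ _ _).symm
  · have h0 : IsLift j p (0 : Cochar k Ks B) ⟨1, one_pos⟩ 0 0 :=
      ⟨by rw [map_zero, nsmul_zero], by rw [map_zero, map_zero]⟩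
    exact (key h0).trans (DirectLimit.zero_def _).symm
  · obtain ⟨m, hm, hm'⟩ := exists_ge_ge (x ω).1 (x ω').1
    have hl := (hx ω).trans hA hm
    have hl' := (hx ω').trans hA hm'
    rw [key (hl.add hl'), key hl, key hl']
    exact (DirectLimit.add_def _ _ _).symm

/-- The maps to the direct limit are injective, because the transition maps are: on character groups
they are composition with the injections `ℤ/n → ℤ/m`. -/
theorem MuColim.of_injective (hC : IsDiagonalizable Ks (Ks ⊗[k] C)) (n : PosDvd) :
    Function.Injective (MuColim.of n : SepHom k Ks (MuRing k n.val) C → _) :=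
  DirectLimit.mk_injective (muTrans k Ks C) (fun n m hnm ψ ψ' hψ => by
    refine charHom_injective hC (AddMonoidHom.ext fun x => zmodMul_injective hnm ?_)
    have := congrArg charHom hψ
    rw [charHom_muTrans, charHom_muTrans] at this
    exact DFunLike.congr_fun this x) n

end ExactSequence

end AffGrp
end

theorem mainTheorem5 {k Ks : Type*} [Field k] [Field Ks] [Algebra k Ks] [IsSepClosure k Ks]
    {A B C : Type*}
    [CommRing A] [HopfAlgebra k A] [Coalgebra.IsCocomm k A]
    [CommRing B] [HopfAlgebra k B] [Coalgebra.IsCocomm k B]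
    [CommRing C] [HopfAlgebra k C] [Coalgebra.IsCocomm k C]
    (hT : AffGrp.IsTorus k Ks A) (hT' : AffGrp.IsTorus k Ks B) (hZ : Module.Finite k C)
    (j : A →ₐc[k] C) (p : B →ₐc[k] A) (h : AffGrp.IsExactSeq j p) :
    AffGrp.IsDiscreteGaloisModule k Ks (AffGrp.Cochar k Ks A) ∧
    AffGrp.IsDiscreteGaloisModule k Ks (AffGrp.Cochar k Ks B) ∧
    AffGrp.IsDiscreteGaloisModule k Ks (AffGrp.MuColim k Ks C) ∧
    ∃ z : AffGrp.Cochar k Ks B →+[Gal(Ks/k)] AffGrp.MuColim k Ks C,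
      Function.Injective
        (AffGrp.SepHom.postcomp (AffGrp.GmRing k) p :
          AffGrp.Cochar k Ks A →+[Gal(Ks/k)] AffGrp.Cochar k Ks B) ∧
      Function.Exact
        (AffGrp.SepHom.postcomp (AffGrp.GmRing k) p :
          AffGrp.Cochar k Ks A →+[Gal(Ks/k)] AffGrp.Cochar k Ks B) z ∧
      Function.Surjective z ∧
      ∀ ω : AffGrp.Cochar k Ks B,
        ∃ (n : AffGrp.PosDvd) (φ : AffGrp.Cochar k Ks A)
          (ψ : AffGrp.SepHom k Ks (AffGrp.MuRing k n.val) C),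
          IsLeast {m : ℕ | 0 < m ∧ ∃ φ' : AffGrp.Cochar k Ks A,
            AffGrp.SepHom.postcomp (AffGrp.GmRing k) p φ' = m • ω} n.val ∧
          AffGrp.SepHom.postcomp (AffGrp.GmRing k) p φ = n.val • ω ∧
          AffGrp.SepHom.postcomp (AffGrp.MuRing k n.val) j ψ =
            AffGrp.SepHom.precomp A (AffGrp.muToGm k n.val) φ ∧
          z ω = AffGrp.MuColim.of n ψ := by
  have hA := hT.isDiagonalizable
  have hB := hT'.isDiagonalizable
  have hC : AffGrp.IsDiagonalizable Ks (Ks ⊗[k] C) :=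
    hA.of_surjective _ (AffGrp.baseChange_surjective h.closed)
  have hfA := hT.finiteType
  have hfB := hT'.finiteType
  have := IsSepClosure.separable (k := k) (K := Ks)
  obtain ⟨z, hz⟩ := AffGrp.exists_connectingHom (Ks := Ks) h hA hB
  refine ⟨AffGrp.isDiscreteGaloisModule_sepHom, AffGrp.isDiscreteGaloisModule_sepHom,
    AffGrp.isDiscreteGaloisModule_muColim, z, AffGrp.postcomp_cochar_injective h hA hB,
    fun ω => ⟨fun hω => ?_, ?_⟩, fun x => ?_, fun ω => ?_⟩
  · obtain ⟨⟨n, ψ⟩, φ, hl⟩ := AffGrp.exists_isLift h hA hB ω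
    -- Since the transition maps are injective, `ψ = 0`, so `φ` is divisible by `n`.
    have hψ : ψ = 0 := AffGrp.MuColim.of_injective hC n
      ((hz ω n φ ψ hl).symm.trans (hω.trans (DirectLimit.zero_def n)))
    have hφ : AffGrp.restrictMu A n.val φ = 0 := by
      rw [← hl.restrictMu_eq, hψ, map_zero]
    obtain ⟨φ', rfl⟩ := AffGrp.exists_eq_nsmul_of_restrictMu_eq_zero hA hφ
    refine ⟨φ', AffGrp.cochar_nsmul_right_injective hB n.pos ?_⟩
    exact (map_nsmul _ _ _).symm.trans hl.postcomp_eq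
  · rintro ⟨φ, rfl⟩
    have hl : AffGrp.IsLift j p (AffGrp.SepHom.postcomp (AffGrp.GmRing k) p φ)
        ⟨1, one_pos⟩ φ 0 := by
      refine ⟨(one_nsmul _).symm, ?_⟩
      have := AffGrp.restrictMu_nsmul_self hA 1 φ
      rw [one_nsmul] at this
      rw [map_zero, this]
    exact (hz _ _ _ _ hl).trans (DirectLimit.zero_def _).symm
  · -- Extend `j ∘ ψ` to a cocharacter `φ` of the torus `Spec A`; its image in `Spec B` is trivial
    -- on `μₙ`, hence of the form `n • ω`.
    obtain ⟨n, ψ, rfl⟩ := DirectLimit.exists_eq_mk (AffGrp.muTrans k Ks C) x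
    obtain ⟨φ, hφ⟩ := hT.restrictMu_surjective n.val (AffGrp.SepHom.postcomp _ j ψ)
    obtain ⟨ω, hω⟩ := AffGrp.exists_eq_nsmul_of_restrictMu_eq_zero (n := n.val)
      (φ := AffGrp.SepHom.postcomp (AffGrp.GmRing k) p φ) hB (by
        rw [AffGrp.postcomp_restrictMu, hφ, AffGrp.postcomp_postcomp_eq_zero h hB])
    exact ⟨ω, hz ω n φ ψ ⟨hω, hφ.symm⟩⟩
  · classical
    have hex := AffGrp.exists_pos_exists_postcomp_eq_nsmul h hA hB ω
    obtain ⟨hn, φ, hφ⟩ := Nat.find_spec hex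
    obtain ⟨ψ, hl⟩ := AffGrp.exists_isLift_of_postcomp_eq (n := ⟨Nat.find hex, hn⟩) h hA hB hφ
    exact ⟨⟨Nat.find hex, hn⟩, φ, ψ, ⟨⟨hn, φ, hφ⟩, fun m hm => Nat.find_min' hex hm⟩, hφ,
      hl.restrictMu_eq, hz ω _ φ ψ hl⟩
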